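/- Let $(X_t)_{t\in\mathbb Z^+}$, $\mathbb Z^+=\{0,1,2,\dots\}$, be a real-valued process adapted to a filtration $(\mathcal F_t)_{t\in\mathbb Z^+}$ on a probability space, with $X_0=0$ a.s. Write $\Delta_t:=X_{t+1}-X_t$, $y^+:=\max(y,0)$ and $y^-:=\max(-y,0)$. Let $\alpha\in(0,1)$ and $\beta>\alpha$. Suppose that there exist (non-random) constants $c>0$, $C<\infty$ and $x_0<\infty$ such that, for all $t\in\mathbb Z^+$, $$\mathbb E\big[(\Delta_t^-)^\beta\mid\mathcal F_t\big]\le C\quad\text{a.s.},$$ and, for all $x\ge x_0$ and all $t\in\mathbb Z^+$, $$\mathbb E\big[\Delta_t^+\mathbf 1\{\Delta_t^+\le x\}\mid\mathcal F_t\big]\ge c\,x^{1-\alpha}\quad\text{a.s.}$$ For $x\in\mathbb R$ let $\lambda_x:=\max\{t\in\mathbb Z^+: X_t\le x\}$ be the last exit time from $(-\infty,x]$, with $\lambda_x:=\infty$ if this set is infinite and $\lambda_x:=0$ if it is empty. Then for every $x\in\mathbb R$ and every $p\in[0,(\beta/\alpha)-1)$, $$\mathbb E[\lambda_x^p]<\infty.$$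 -/

import Mathlib

open MeasureTheory ProbabilityTheory
open scoped ENNReal

/-- The increment `Δ_t = X_{t+1} - X_t` of a real-valued process in discrete time. -/
def increment {Ω : Type*} (X : ℕ → Ω → ℝ) (t : ℕ) (ω : Ω) : ℝ :=
  X (t + 1) ω - X t ω

/-- The last exit time `λ_x = max {t : X_t ≤ x}` of the path `ω` from the half-line `(-∞, x]`,
as the supremum in `ℕ ∪ {∞}` of the times spent there: it is the maximum when the path has a last
visit, `∞` when there are infinitely many visits, and `0` when there are none. -/
noncomputable def lastExitTime {Ω : Type*} (X : ℕ → Ω → ℝ) (x : ℝ) (ω : Ω) : ℕ∞ :=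
  ⨆ (t : ℕ) (_ : X t ω ≤ x), (t : ℕ∞)

/-- The uniform conditional moment bound `E[(Δ_t⁻)^β | ℱ_t] ≤ C` a.s., for all `t`. The
conditional expectation is that of a nonnegative variable, with values in `[0, ∞]`, so that no
integrability is presupposed. -/
def NegPartMomentBound {Ω : Type*} {m : MeasurableSpace Ω} (μ : Measure Ω) (ℱ : Filtration ℕ m)
    (X : ℕ → Ω → ℝ) (β C : ℝ) : Prop :=
  ∀ t : ℕ, ∀ᵐ ω ∂μ,
    (μ⁻[fun ω' => ENNReal.ofReal ((increment X t ω')⁻ ^ β) | ℱ t]) ω ≤ ENNReal.ofReal C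

/-- The lower bound `E[Δ_t⁺ 1{Δ_t⁺ ≤ x} | ℱ_t] ≥ c x^(1-α)` a.s., for all `x ≥ x₀` and all `t`.
The truncated variable is bounded, hence integrable under a probability measure. -/
def TruncatedPosPartLowerBound {Ω : Type*} {m : MeasurableSpace Ω} (μ : Measure Ω)
    (ℱ : Filtration ℕ m) (X : ℕ → Ω → ℝ) (α c x₀ : ℝ) : Prop :=
  ∀ x : ℝ, x₀ ≤ x → ∀ t : ℕ, ∀ᵐ ω ∂μ,
    c * x ^ (1 - α) ≤
      (μ[{ω' | (increment X t ω')⁺ ≤ x}.indicator (fun ω' => (increment X t ω')⁺) | ℱ t]) ω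

open Filter Topology

/-! Fix a time block `[N, 2N)` and truncate the increments at level `y = N ^ θ`. Unless some
negative jump before time `2N` exceeds `y`, which by Markov has probability `O(N * y ^ (-β))`, the
truncated sum lies below `X` throughout the block. Scaled by `1 / y`, a truncated increment has
conditional drift of order at least `y ^ (-α)`, up to a negative-part error `O(y ^ (-min β 1))` of
smaller order. Hence its exponential moment is at most `exp (-(c / 4) * y ^ (-α))`
(`eventually_condExp_exp_neg_truncate_le`), and a Chernoff bound makes a truncated sum below `x`
have probability `O(exp (-(c / 4) * N ^ (1 - α * θ)))`. With `α * θ < 1`, a visit in the block has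
probability `O(N ^ (1 - θ * β))` (`measure_exists_le_block_le`, `block_bound_isBigO`). Weighting by
`N ^ p` and summing over dyadic `N` converges once `θ * β > 1 + p`. -/

/-- The increment `d` with its positive part set to zero when it exceeds `y`, and its negative part
cut off at `y`. -/
noncomputable def truncate (y d : ℝ) : ℝ :=
  {e : ℝ | e⁺ ≤ y}.indicator (fun e => e⁺) d - min d⁻ y

/-! ### Pointwise estimates for one truncated increment. -/

lemma measurable_truncatedPosPart (y : ℝ) :
    Measurable ({e : ℝ | e⁺ ≤ y}.indicator (fun e : ℝ => e⁺)) := by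
  have h : Measurable (fun e : ℝ => e⁺) := measurable_id.posPart
  exact h.indicator (measurableSet_le h measurable_const)

lemma measurable_truncate (y : ℝ) : Measurable (truncate y) :=
  (measurable_truncatedPosPart y).sub (measurable_id.negPart.min measurable_const)

lemma truncatedPosPart_nonneg (y d : ℝ) : 0 ≤ {e : ℝ | e⁺ ≤ y}.indicator (fun e => e⁺) d :=
  Set.indicator_nonneg (fun e _ => posPart_nonneg e) d

lemma truncatedPosPart_le {y : ℝ} (hy : 0 ≤ y) (d : ℝ) :
    {e : ℝ | e⁺ ≤ y}.indicator (fun e => e⁺) d ≤ y :=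
  Set.indicator_apply_le' (fun h => h) (fun _ => hy)

lemma abs_truncate_le {y : ℝ} (hy : 0 ≤ y) (d : ℝ) : |truncate y d| ≤ y := by
  have h1 := truncatedPosPart_nonneg y d
  have h2 := truncatedPosPart_le hy d
  have h3 : 0 ≤ min d⁻ y := le_min (negPart_nonneg d) hy
  have h4 : min d⁻ y ≤ y := min_le_right _ _
  rw [truncate, abs_le]
  constructor <;> linarith

lemma truncate_le {y d : ℝ} (hd : d⁻ ≤ y) : truncate y d ≤ d := by
  have h : {e : ℝ | e⁺ ≤ y}.indicator (fun e => e⁺) d ≤ d⁺ :=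
    Set.indicator_apply_le' (fun _ => le_rfl) (fun _ => posPart_nonneg d)
  have h2 := posPart_sub_negPart d
  rw [truncate, min_eq_left hd]
  linarith

lemma exp_neg_le_one_sub_half {u : ℝ} (h0 : 0 ≤ u) (h1 : u ≤ 1) :
    Real.exp (-u) ≤ 1 - u / 2 := by
  rw [Real.exp_neg, inv_le_comm₀ (Real.exp_pos u) (by linarith)]
  refine le_trans ?_ (Real.add_one_le_exp u)
  rw [inv_le_iff_one_le_mul₀ (by linarith)]
  nlinarith

lemma exp_le_one_add_two_mul {u : ℝ} (h0 : 0 ≤ u) (h1 : u ≤ 1) :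
    Real.exp u ≤ 1 + 2 * u := by
  have h := Real.abs_exp_sub_one_le (x := u) (by rwa [abs_of_nonneg h0])
  rw [abs_of_nonneg h0] at h
  linarith [le_abs_self (Real.exp u - 1)]

/-- The ratio lies in `[0, 1]`, so lowering its exponent to `min β 1` only increases it; this treats
`β < 1` and `β ≥ 1` together. -/
lemma min_div_le_rpow {y v β : ℝ} (hy : 0 < y) (hv : 0 ≤ v) (hβ : 0 < β) :
    min v y / y ≤ y ^ (-min β 1) * (1 + v ^ β) := by
  have hγ : 0 < min β 1 := lt_min hβ one_pos
  have hu0 : 0 ≤ min v y / y := div_nonneg (le_min hv hy.le) hy.le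
  have hu1 : min v y / y ≤ 1 := (div_le_one hy).2 (min_le_right _ _)
  calc min v y / y ≤ (min v y / y) ^ (min β 1) := by
        conv_lhs => rw [← Real.rpow_one (min v y / y)]
        exact Real.rpow_le_rpow_of_exponent_ge' hu0 hu1 hγ.le (min_le_right _ _)
    _ ≤ (v / y) ^ (min β 1) := by
        gcongr
        exact min_le_left _ _
    _ = y ^ (-min β 1) * v ^ (min β 1) := by
        rw [Real.div_rpow hv hy.le, Real.rpow_neg hy.le, div_eq_inv_mul]
    _ ≤ y ^ (-min β 1) * (1 + v ^ β) := by
        gcongr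
        rcases le_total v 1 with h | h
        · have := Real.rpow_le_one hv h hγ.le
          have := Real.rpow_nonneg hv β
          linarith
        · have := Real.rpow_le_rpow_of_exponent_le h (min_le_left β 1)
          linarith

lemma exp_neg_truncate_div_le {y β : ℝ} (hy : 0 < y) (hβ : 0 < β) (d : ℝ) :
    Real.exp (-(truncate y d / y)) ≤
      1 - (2 * y)⁻¹ * {e : ℝ | e⁺ ≤ y}.indicator (fun e => e⁺) d
        + 2 * y ^ (-min β 1) * (1 + d⁻ ^ β) := by
  rcases le_total 0 d with hd | hd
  · have h1 := truncatedPosPart_nonneg y d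
    have h2 := truncatedPosPart_le hy.le d
    have h := exp_neg_le_one_sub_half (div_nonneg h1 hy.le) ((div_le_one hy).2 h2)
    have h3 : 0 ≤ 2 * y ^ (-min β 1) * (1 + d⁻ ^ β) := by positivity
    have ht : truncate y d = {e : ℝ | e⁺ ≤ y}.indicator (fun e => e⁺) d := by
      rw [truncate, negPart_of_nonneg hd, min_eq_left hy.le, sub_zero]
    rw [ht]
    refine h.trans ?_
    rw [mul_inv, ← div_eq_inv_mul] at *
    have : {e : ℝ | e⁺ ≤ y}.indicator (fun e => e⁺) d / y / 2 =
      2⁻¹ * y⁻¹ * {e : ℝ | e⁺ ≤ y}.indicator (fun e => e⁺) d := by ring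
    linarith
  · have hp : {e : ℝ | e⁺ ≤ y}.indicator (fun e => e⁺) d = 0 := by
      simp [Set.indicator_apply, posPart_eq_zero.2 hd]
    have hu0 : 0 ≤ min d⁻ y / y := div_nonneg (le_min (negPart_nonneg d) hy.le) hy.le
    have hu1 : min d⁻ y / y ≤ 1 := (div_le_one hy).2 (min_le_right _ _)
    have h := exp_le_one_add_two_mul hu0 hu1
    have h2 := min_div_le_rpow hy (negPart_nonneg d) hβ
    rw [truncate, hp, zero_sub, neg_div, neg_neg]
    linarith

/-! ### Conditional moments of an increment. -/

section AdaptedProcess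

variable {Ω : Type*} {m : MeasurableSpace Ω} {μ : Measure Ω} [IsProbabilityMeasure μ]
  {ℱ : Filtration ℕ m} {X : ℕ → Ω → ℝ} {α β c C x₀ : ℝ}

lemma measurable_increment (hX : Adapted ℱ X) (t : ℕ) : Measurable[ℱ (t + 1)] (increment X t) :=
  (hX (t + 1)).sub ((hX t).mono (ℱ.mono t.le_succ) le_rfl)

lemma measurable_increment' (hX : Adapted ℱ X) (t : ℕ) : Measurable (increment X t) :=
  (measurable_increment hX t).mono (ℱ.le _) le_rfl

lemma measurable_negPart_rpow (hX : Adapted ℱ X) (t : ℕ) :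
    Measurable fun ω => (increment X t ω)⁻ ^ β :=
  (measurable_increment' hX t).negPart.pow_const β

lemma lintegral_negPart_rpow_le (hC : NegPartMomentBound μ ℱ X β C) (t : ℕ) :
    ∫⁻ ω, ENNReal.ofReal ((increment X t ω)⁻ ^ β) ∂μ ≤ ENNReal.ofReal C := by
  rw [← lintegral_condLExp (ℱ.le t)]
  exact (lintegral_mono_ae (hC t)).trans (by simp)

lemma integrable_negPart_rpow (hX : Adapted ℱ X) (hC : NegPartMomentBound μ ℱ X β C) (t : ℕ) :
    Integrable (fun ω => (increment X t ω)⁻ ^ β) μ := by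
  refine ⟨(measurable_negPart_rpow hX t).aestronglyMeasurable, ?_⟩
  rw [hasFiniteIntegral_iff_ofReal (ae_of_all _ fun ω => by positivity)]
  exact (lintegral_negPart_rpow_le hC t).trans_lt ENNReal.ofReal_lt_top

lemma condExp_negPart_rpow_le (hX : Adapted ℱ X) (hC : NegPartMomentBound μ ℱ X β C) (t : ℕ) :
    ∀ᵐ ω ∂μ, (μ[fun ω' => (increment X t ω')⁻ ^ β | ℱ t]) ω ≤ max C 0 := by
  have h := condLExp_ofReal (ℱ t) (integrable_negPart_rpow hX hC t)
    (ae_of_all _ fun ω => by positivity)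
  filter_upwards [h, hC t] with ω h1 h2
  rw [h1] at h2
  by_contra! h3
  -- `ENNReal.ofReal` clips a negative `C` to zero, hence `max C 0`.
  have h4 := (ENNReal.ofReal_le_ofReal_iff' ).1 h2
  rcases h4 with h4 | h4
  · exact absurd (h4.trans (le_max_left C 0)) h3.not_ge
  · exact absurd (h4.trans (le_max_right C 0)) h3.not_ge

lemma measure_negPart_gt_le (hX : Adapted ℱ X) (hC : NegPartMomentBound μ ℱ X β C) (hβ : 0 < β)
    {y : ℝ} (hy : 0 < y) (t : ℕ) :
    μ.real {ω | y < (increment X t ω)⁻} ≤ max C 0 * y ^ (-β) := by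
  have hy' : 0 < y ^ β := Real.rpow_pos_of_pos hy β
  have h1 := mul_meas_ge_le_integral_of_nonneg
    (ae_of_all μ fun ω => (by positivity : (0 : ℝ) ≤ (increment X t ω)⁻ ^ β))
    (integrable_negPart_rpow hX hC t) (y ^ β)
  have h2 : ∫ ω, (increment X t ω)⁻ ^ β ∂μ ≤ max C 0 := by
    rw [← integral_condExp (ℱ.le t)]
    calc _ ≤ ∫ _, max C 0 ∂μ :=
          integral_mono_ae integrable_condExp (integrable_const _) (condExp_negPart_rpow_le hX hC t)
      _ = max C 0 := by simp
  have h3 : μ.real {ω | y < (increment X t ω)⁻} ≤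
      μ.real {ω | y ^ β ≤ (increment X t ω)⁻ ^ β} := by
    refine measureReal_mono fun ω hω => ?_
    exact Real.rpow_le_rpow hy.le (le_of_lt hω) hβ.le
  rw [Real.rpow_neg hy.le, ← div_eq_mul_inv, le_div_iff₀ hy', mul_comm]
  exact (mul_le_mul_of_nonneg_left h3 hy'.le).trans (h1.trans h2)

lemma condExp_exp_neg_truncate_le (hX : Adapted ℱ X) (hC : NegPartMomentBound μ ℱ X β C)
    (hc : TruncatedPosPartLowerBound μ ℱ X α c x₀) (hβ : 0 < β) {y : ℝ} (hy : 0 < y)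
    (hy₀ : x₀ ≤ y) (t : ℕ) :
    ∀ᵐ ω ∂μ, (μ[fun ω' => Real.exp (-(truncate y (increment X t ω') / y)) | ℱ t]) ω ≤
      1 - c / 2 * y ^ (-α) + 2 * (1 + max C 0) * y ^ (-min β 1) := by
  set P : Ω → ℝ := {ω' | (increment X t ω')⁺ ≤ y}.indicator (fun ω' => (increment X t ω')⁺) with hP
  set V : Ω → ℝ := fun ω' => (increment X t ω')⁻ ^ β with hV
  set E : Ω → ℝ := fun ω' => Real.exp (-(truncate y (increment X t ω') / y)) with hE
  have hPeq : ∀ ω, P ω = {e : ℝ | e⁺ ≤ y}.indicator (fun e => e⁺) (increment X t ω) := fun ω => rfl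
  have hΔ := measurable_increment' hX t
  have hPm : Measurable P := (measurable_truncatedPosPart y).comp hΔ
  have hPi : Integrable P μ := by
    refine Integrable.of_bound hPm.aestronglyMeasurable y (ae_of_all _ fun ω => ?_)
    rw [hPeq, Real.norm_of_nonneg (truncatedPosPart_nonneg _ _)]
    exact truncatedPosPart_le hy.le _
  have hVi : Integrable V μ := integrable_negPart_rpow hX hC t
  have hEm : Measurable E := (((measurable_truncate y).comp hΔ).div_const y).neg.exp
  have hEi : Integrable E μ := by
    refine Integrable.of_bound hEm.aestronglyMeasurable (Real.exp 1) (ae_of_all _ fun ω => ?_)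
    rw [Real.norm_of_nonneg (Real.exp_pos _).le, Real.exp_le_exp]
    have := abs_le.1 (abs_truncate_le hy.le (increment X t ω))
    rw [neg_le, le_div_iff₀ hy]
    linarith
  set k := 2 * y ^ (-min β 1) with hk
  have hk0 : 0 ≤ k := by positivity
  have hle : E ≤ᵐ[μ] (fun _ => 1 + k) + ((-(2 * y)⁻¹) • P + k • V) := by
    refine ae_of_all _ fun ω => ?_
    have := exp_neg_truncate_div_le hy hβ (increment X t ω)
    simp only [Pi.add_apply, Pi.smul_apply, smul_eq_mul, hPeq, hV, hE]
    linarith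
  have hsi : Integrable ((-(2 * y)⁻¹) • P + k • V) μ := (hPi.smul _).add (hVi.smul _)
  have h1 := condExp_mono (m := ℱ t) hEi ((integrable_const _).add hsi) hle
  have h2 := condExp_add (m := ℱ t) (μ := μ) (integrable_const (1 + k)) hsi
  have h3 := condExp_add (m := ℱ t) (hPi.smul (-(2 * y)⁻¹)) (hVi.smul k)
  have h4 := condExp_smul (μ := μ) (-(2 * y)⁻¹) P (ℱ t)
  have h5 := condExp_smul (μ := μ) k V (ℱ t)
  have h6 := condExp_const (μ := μ) (ℱ.le t) (1 + k)
  filter_upwards [h1, h2, h3, h4, h5, hc y hy₀ t, condExp_negPart_rpow_le hX hC t]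
    with ω h1 h2 h3 h4 h5 hc hC
  rw [h2, Pi.add_apply, h6, h3, Pi.add_apply, h4, h5] at h1
  simp only [Pi.smul_apply, smul_eq_mul] at h1
  refine h1.trans ?_
  have e1 : c / 2 * y ^ (-α) ≤ (2 * y)⁻¹ * (μ[P | ℱ t]) ω := by
    refine le_trans (le_of_eq ?_) (mul_le_mul_of_nonneg_left hc (by positivity))
    rw [sub_eq_add_neg, Real.rpow_add hy, Real.rpow_one]
    field_simp
  have e2 : k * (μ[V | ℱ t]) ω ≤ k * max C 0 := mul_le_mul_of_nonneg_left hC hk0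
  nlinarith

/-! ### Exponential moments of truncated sums. -/

/-- The sum of the first `n` truncated increments. -/
noncomputable def truncatedSum (X : ℕ → Ω → ℝ) (y : ℝ) (n : ℕ) (ω : Ω) : ℝ :=
  ∑ t ∈ Finset.range n, truncate y (increment X t ω)

lemma measurable_truncatedSum (hX : Adapted ℱ X) (y : ℝ) (n : ℕ) :
    Measurable[ℱ n] (truncatedSum X y n) := by
  refine Finset.measurable_fun_sum (m := ℱ n) _ fun t ht => (measurable_truncate y).comp ?_
  exact (measurable_increment hX t).mono (ℱ.mono (Finset.mem_range.1 ht)) le_rfl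

lemma norm_exp_neg_truncatedSum_le {y : ℝ} (hy : 0 < y) (n : ℕ) (ω : Ω) :
    ‖Real.exp (-(truncatedSum X y n ω / y))‖ ≤ Real.exp n := by
  rw [Real.norm_of_nonneg (Real.exp_pos _).le, Real.exp_le_exp, neg_le, le_div_iff₀ hy,
    truncatedSum]
  calc -(n : ℝ) * y = ∑ t ∈ Finset.range n, (-y) := by simp
    _ ≤ _ := Finset.sum_le_sum fun t _ => (abs_le.1 (abs_truncate_le hy.le _)).1

lemma integrable_exp_neg_truncatedSum (hX : Adapted ℱ X) {y : ℝ} (hy : 0 < y) (n : ℕ) :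
    Integrable (fun ω => Real.exp (-(truncatedSum X y n ω / y))) μ := by
  have h := ((measurable_truncatedSum hX y n).mono (ℱ.le n) le_rfl)
  exact Integrable.of_bound (h.div_const y).neg.exp.aestronglyMeasurable (Real.exp n)
    (ae_of_all _ fun ω => norm_exp_neg_truncatedSum_le hy n ω)

/-- Conditioning on `ℱ n` pulls out the bounded factor of the first `n` steps, leaving one factor
`ρ` per step. -/
lemma integral_exp_neg_truncatedSum_le (hX : Adapted ℱ X) {y ρ : ℝ} (hy : 0 < y) (hρ : 0 ≤ ρ)
    (h : ∀ t, ∀ᵐ ω ∂μ,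
      (μ[fun ω' => Real.exp (-(truncate y (increment X t ω') / y)) | ℱ t]) ω ≤ ρ) (n : ℕ) :
    ∫ ω, Real.exp (-(truncatedSum X y n ω / y)) ∂μ ≤ ρ ^ n := by
  induction n with
  | zero => simp [truncatedSum]
  | succ n ih =>
    set W : Ω → ℝ := fun ω => Real.exp (-(truncatedSum X y n ω / y)) with hW
    set E : Ω → ℝ := fun ω => Real.exp (-(truncate y (increment X n ω) / y)) with hE
    have hWE : (fun ω => Real.exp (-(truncatedSum X y (n + 1) ω / y))) = W * E := by
      ext ω
      simp only [hW, hE, Pi.mul_apply, ← Real.exp_add, truncatedSum, Finset.sum_range_succ]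
      ring_nf
    have hWm : StronglyMeasurable[ℱ n] W :=
      ((measurable_truncatedSum hX y n).div_const y).neg.exp.stronglyMeasurable
    have hEi : Integrable E μ := by
      have hEm : Measurable E := (((measurable_truncate y).comp
        (measurable_increment' hX n)).div_const y).neg.exp
      refine Integrable.of_bound hEm.aestronglyMeasurable (Real.exp 1) (ae_of_all _ fun ω => ?_)
      rw [Real.norm_of_nonneg (Real.exp_pos _).le, Real.exp_le_exp]
      have := abs_le.1 (abs_truncate_le hy.le (increment X n ω))
      rw [neg_le, le_div_iff₀ hy]
      linarith
    have hpull := condExp_stronglyMeasurable_mul_of_bound (ℱ.le n) hWm hEi (Real.exp n)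
      (ae_of_all _ fun ω => norm_exp_neg_truncatedSum_le hy n ω)
    calc ∫ ω, Real.exp (-(truncatedSum X y (n + 1) ω / y)) ∂μ
        = ∫ ω, (μ[W * E | ℱ n]) ω ∂μ := by rw [integral_condExp (ℱ.le n), ← hWE]
      _ ≤ ∫ ω, ρ * W ω ∂μ := by
          refine integral_mono_ae integrable_condExp
            ((integrable_exp_neg_truncatedSum hX hy n).const_mul ρ) ?_
          filter_upwards [hpull, h n] with ω h1 h2
          rw [h1, Pi.mul_apply, mul_comm]
          exact mul_le_mul_of_nonneg_right h2 (Real.exp_pos _).le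
      _ ≤ ρ ^ (n + 1) := by
          rw [integral_const_mul, pow_succ']
          exact mul_le_mul_of_nonneg_left ih hρ

lemma truncatedSum_le {y : ℝ} {n : ℕ} {ω : Ω} (h0 : X 0 ω = 0)
    (h : ∀ t < n, (increment X t ω)⁻ ≤ y) : truncatedSum X y n ω ≤ X n ω := by
  calc truncatedSum X y n ω ≤ ∑ t ∈ Finset.range n, increment X t ω :=
        Finset.sum_le_sum fun t ht => truncate_le (h t (Finset.mem_range.1 ht))
    _ = X n ω := by
        simp only [increment]
        rw [Finset.sum_range_sub (fun t => X t ω), h0, sub_zero]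

/-- Chernoff bound at parameter `1 / y`; as `y ≥ 1`, `x / y ≤ |x|` keeps the prefactor free of `y`.
-/
lemma measure_truncatedSum_le_le (hX : Adapted ℱ X) {y κ : ℝ} (hy : 1 ≤ y)
    (h : ∀ t, ∀ᵐ ω ∂μ,
      (μ[fun ω' => Real.exp (-(truncate y (increment X t ω') / y)) | ℱ t]) ω ≤ Real.exp (-κ))
    (n : ℕ) (x : ℝ) :
    μ.real {ω | truncatedSum X y n ω ≤ x} ≤ Real.exp |x| * Real.exp (-(κ * n)) := by
  have hy0 : 0 < y := one_pos.trans_le hy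
  have h1 := integral_exp_neg_truncatedSum_le hX hy0 (Real.exp_pos _).le h n
  have h2 := mul_meas_ge_le_integral_of_nonneg
    (ae_of_all μ fun ω => (Real.exp_pos (-(truncatedSum X y n ω / y))).le)
    (integrable_exp_neg_truncatedSum hX hy0 n) (Real.exp (-|x|))
  have h3 : μ.real {ω | truncatedSum X y n ω ≤ x} ≤
      μ.real {ω | Real.exp (-|x|) ≤ Real.exp (-(truncatedSum X y n ω / y))} := by
    refine measureReal_mono fun ω hω => ?_
    change truncatedSum X y n ω ≤ x at hω
    change Real.exp _ ≤ Real.exp _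
    rw [Real.exp_le_exp, neg_le_neg_iff, div_le_iff₀ hy0]
    exact hω.trans ((le_abs_self x).trans (le_mul_of_one_le_right (abs_nonneg x) hy))
  rw [← Real.exp_nat_mul, mul_neg, mul_comm (n : ℝ)] at h1
  have h4 := (mul_le_mul_of_nonneg_left h3 (Real.exp_pos (-|x|)).le).trans (h2.trans h1)
  rwa [Real.exp_neg, inv_mul_le_iff₀ (Real.exp_pos _)] at h4

/-- Since `α < min β 1`, for large `y` the negative-part error costs at most half of the drift term
`c / 2 * y ^ (-α)`. -/
lemma eventually_condExp_exp_neg_truncate_le (hX : Adapted ℱ X) (hα : 0 < α) (hα1 : α < 1)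
    (hβ : α < β) (h0 : 0 < c) (hC : NegPartMomentBound μ ℱ X β C)
    (hc : TruncatedPosPartLowerBound μ ℱ X α c x₀) :
    ∀ᶠ y in atTop, ∀ t, ∀ᵐ ω ∂μ,
      (μ[fun ω' => Real.exp (-(truncate y (increment X t ω') / y)) | ℱ t]) ω ≤
        Real.exp (-(c / 4 * y ^ (-α))) := by
  have hγ : 0 < min β 1 - α := sub_pos.2 (lt_min hβ hα1)
  have hlim : Tendsto (fun y : ℝ => 2 * (1 + max C 0) * y ^ (-(min β 1 - α))) atTop (𝓝 0) := by
    simpa using (tendsto_rpow_neg_atTop hγ).const_mul (2 * (1 + max C 0))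
  filter_upwards [hlim.eventually_le_const (show (0 : ℝ) < c / 4 by positivity),
    eventually_ge_atTop x₀, eventually_gt_atTop 0] with y h1 h2 h3 t
  filter_upwards [condExp_exp_neg_truncate_le hX hC hc (hα.trans hβ) h3 h2 t] with ω h
  refine h.trans (le_trans ?_ (Real.add_one_le_exp _))
  have e : y ^ (-min β 1) = y ^ (-(min β 1 - α)) * y ^ (-α) := by
    rw [← Real.rpow_add h3]
    ring_nf
  have := mul_le_mul_of_nonneg_right h1 (Real.rpow_nonneg h3.le (-α))
  rw [e]
  linarith

/-! ### Dyadic time blocks. -/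

/-- Probability of a visit to `(-∞, x]` during the time block `[N, 2N)`. -/
lemma measure_exists_le_block_le (hX : Adapted ℱ X) (hX0 : ∀ᵐ ω ∂μ, X 0 ω = 0) (hβ : 0 < β)
    (hC : NegPartMomentBound μ ℱ X β C) {y κ : ℝ} (hy : 1 ≤ y) (hκ : 0 ≤ κ)
    (h : ∀ t, ∀ᵐ ω ∂μ,
      (μ[fun ω' => Real.exp (-(truncate y (increment X t ω') / y)) | ℱ t]) ω ≤ Real.exp (-κ))
    (x : ℝ) (N : ℕ) :
    μ.real {ω | ∃ s ∈ Finset.Ico N (2 * N), X s ω ≤ x} ≤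
      2 * N * (max C 0 * y ^ (-β)) + N * (Real.exp |x| * Real.exp (-(κ * N))) := by
  have hsub : μ.real {ω | ∃ s ∈ Finset.Ico N (2 * N), X s ω ≤ x} ≤
      μ.real ((⋃ t ∈ Finset.range (2 * N), {ω | y < (increment X t ω)⁻}) ∪
        ⋃ s ∈ Finset.Ico N (2 * N), {ω | truncatedSum X y s ω ≤ x}) := by
    refine ENNReal.toReal_mono (measure_ne_top _ _) (measure_mono_ae ?_)
    filter_upwards [hX0] with ω h0
    rintro ⟨s, hs, hsx⟩
    -- Jumps from time `0` on count, since the truncated sum must lie below `X` from the start.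
    by_cases hb : ∃ t ∈ Finset.range (2 * N), y < (increment X t ω)⁻
    · left
      obtain ⟨t, ht, hty⟩ := hb
      exact Set.mem_biUnion ht hty
    · right
      push Not at hb
      refine Set.mem_biUnion (x := s) hs ((truncatedSum_le h0 fun t ht => hb t ?_).trans hsx)
      exact Finset.mem_range.2 (ht.trans (Finset.mem_Ico.1 hs).2)
  refine hsub.trans ((measureReal_union_le _ _).trans (add_le_add ?_ ?_))
  · refine (measureReal_biUnion_finset_le _ _).trans ?_
    refine (Finset.sum_le_card_nsmul _ _ _ fun t _ =>
      measure_negPart_gt_le hX hC hβ (one_pos.trans_le hy) t).trans (le_of_eq ?_)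
    simp
  · refine (measureReal_biUnion_finset_le _ _).trans ?_
    refine (Finset.sum_le_card_nsmul _ _ (Real.exp |x| * Real.exp (-(κ * N)))
      fun s hs => ?_).trans (le_of_eq ?_)
    · refine (measure_truncatedSum_le_le hX hy h s x).trans ?_
      have : (N : ℝ) ≤ s := Nat.cast_le.2 (Finset.mem_Ico.1 hs).1
      gcongr
    · simp [two_mul]

lemma lastExitTime_rpow_le {p : ℝ} (hp : 0 ≤ p) (x : ℝ) (ω : Ω) :
    (lastExitTime X x ω : ℝ≥0∞) ^ p ≤
      1 + ∑' k : ℕ, {ω' | ∃ s ∈ Finset.Ico (2 ^ k) (2 * 2 ^ k), X s ω' ≤ x}.indicator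
        (fun _ => ENNReal.ofReal ((2 * 2 ^ k : ℝ) ^ p)) ω := by
  -- For `p = 0` the left side is `1` even at `0` and `∞`; only here is the summand `1` needed.
  rcases hp.eq_or_lt with rfl | hp0
  · simp
  rw [← ENNReal.le_rpow_inv_iff hp0, lastExitTime]
  simp only [ENat.toENNReal_iSup, iSup_le_iff]
  intro s hs
  rw [ENNReal.le_rpow_inv_iff hp0, ENat.toENNReal_coe]
  rcases Nat.eq_zero_or_pos s with rfl | hpos
  · simp [ENNReal.zero_rpow_of_pos hp0]
  have h1 : 2 ^ Nat.log 2 s ≤ s := Nat.pow_log_le_self 2 hpos.ne'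
  have h2 : s < 2 * 2 ^ Nat.log 2 s := by
    rw [← pow_succ']
    exact Nat.lt_pow_succ_log_self one_lt_two s
  refine le_trans ?_ (le_add_of_nonneg_left zero_le_one)
  refine le_trans ?_ (ENNReal.le_tsum (Nat.log 2 s))
  have hmem : ω ∈ {ω' | ∃ r ∈ Finset.Ico (2 ^ Nat.log 2 s) (2 * 2 ^ Nat.log 2 s), X r ω' ≤ x} :=
    ⟨s, Finset.mem_Ico.2 ⟨h1, h2⟩, hs⟩
  rw [Set.indicator_of_mem hmem,
    ← ENNReal.ofReal_natCast, ENNReal.ofReal_rpow_of_nonneg s.cast_nonneg hp]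
  have h3 : (s : ℝ) ≤ 2 * 2 ^ Nat.log 2 s := by exact_mod_cast h2.le
  gcongr

lemma lintegral_lastExitTime_rpow_lt_top (hX : Adapted ℱ X) {p : ℝ} (hp : 0 ≤ p) (x : ℝ)
    (h : Summable fun k : ℕ => (2 * 2 ^ k : ℝ) ^ p *
      μ.real {ω | ∃ s ∈ Finset.Ico (2 ^ k) (2 * 2 ^ k), X s ω ≤ x}) :
    ∫⁻ ω, (lastExitTime X x ω : ℝ≥0∞) ^ p ∂μ < ∞ := by
  have hm : ∀ k : ℕ, MeasurableSet {ω | ∃ s ∈ Finset.Ico (2 ^ k) (2 * 2 ^ k), X s ω ≤ x} := by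
    intro k
    have : {ω | ∃ s ∈ Finset.Ico (2 ^ k) (2 * 2 ^ k), X s ω ≤ x} =
        ⋃ s ∈ Finset.Ico (2 ^ k) (2 * 2 ^ k), {ω | X s ω ≤ x} := by
      ext ω
      simp
    rw [this]
    exact Finset.measurableSet_biUnion _ fun s _ =>
      measurableSet_le ((hX s).mono (ℱ.le s) le_rfl) measurable_const
  refine (lintegral_mono fun ω => lastExitTime_rpow_le hp x ω).trans_lt ?_
  rw [lintegral_add_left measurable_const,
    lintegral_tsum fun k => (measurable_const.indicator (hm k)).aemeasurable]
  refine ENNReal.add_lt_top.2 ⟨by simp, ?_⟩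
  refine lt_of_eq_of_lt (tsum_congr fun k => ?_) h.tsum_ofReal_lt_top
  rw [lintegral_indicator_const (hm k), ENNReal.ofReal_mul (by positivity), ofReal_measureReal]

end AdaptedProcess

/-! ### Asymptotics in the block length, and conclusion. -/

lemma exp_neg_mul_rpow_isBigO {b η : ℝ} (hb : 0 < b) (hη : 0 < η) (r : ℝ) :
    (fun N : ℝ => Real.exp (-(b * N ^ η))) =O[atTop] fun N : ℝ => N ^ r := by
  have h := ((isLittleO_exp_neg_mul_rpow_atTop hb (r / η)).comp_tendsto
    (tendsto_rpow_atTop hη)).isBigO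
  refine h.congr' (.of_forall fun N => by simp) ?_
  filter_upwards [eventually_ge_atTop 0] with N hN
  rw [Function.comp_apply, ← Real.rpow_mul hN, mul_div_cancel₀ _ hη.ne']

lemma block_bound_isBigO {α β θ b p : ℝ} (hb : 0 < b) (hθα : α * θ < 1) (D E : ℝ) :
    (fun N : ℝ => (2 * N) ^ p * (2 * N * (D * (N ^ θ) ^ (-β)) +
      N * (E * Real.exp (-(b * (N ^ θ) ^ (-α) * N))))) =O[atTop]
        fun N : ℝ => N ^ (-(θ * β - 1 - p)) := by
  have hexp : (fun N : ℝ => Real.exp (-(b * (N ^ θ) ^ (-α) * N))) =O[atTop]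
      fun N : ℝ => N ^ (-(θ * β)) := by
    refine (exp_neg_mul_rpow_isBigO hb (sub_pos.2 hθα) (-(θ * β))).congr' ?_ .rfl
    filter_upwards [eventually_gt_atTop 0] with N hN
    rw [← Real.rpow_mul hN.le, mul_assoc b, ← Real.rpow_add_one hN.ne']
    ring_nf
  have hpow : (fun N : ℝ => (N ^ θ) ^ (-β)) =O[atTop] fun N : ℝ => N ^ (-(θ * β)) := by
    refine (Asymptotics.isBigO_refl _ _).congr' ?_ .rfl
    filter_upwards [eventually_ge_atTop 0] with N hN
    rw [← Real.rpow_mul hN, mul_neg]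
  have hp2 : (fun N : ℝ => (2 * N) ^ p) =O[atTop] fun N : ℝ => N ^ p := by
    refine (Asymptotics.isBigO_const_mul_self ((2 : ℝ) ^ p) (fun N : ℝ => N ^ p) _).congr' ?_ .rfl
    filter_upwards [eventually_ge_atTop 0] with N hN
    rw [Real.mul_rpow zero_le_two hN]
  have hsum : (fun N : ℝ => 2 * N * (D * (N ^ θ) ^ (-β)) +
      N * (E * Real.exp (-(b * (N ^ θ) ^ (-α) * N)))) =O[atTop]
        fun N : ℝ => N * N ^ (-(θ * β)) :=
    ((Asymptotics.isBigO_const_mul_self 2 (fun N : ℝ => N) _).mul (hpow.const_mul_left D)).add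
      ((Asymptotics.isBigO_refl _ _).mul (hexp.const_mul_left E))
  refine (hp2.mul hsum).congr' .rfl ?_
  filter_upwards [eventually_gt_atTop 0] with N hN
  rw [mul_comm N, ← Real.rpow_add_one hN.ne', ← Real.rpow_add hN]
  ring_nf

theorem theorem2p8 {Ω : Type*} {m : MeasurableSpace Ω} (μ : Measure Ω) [IsProbabilityMeasure μ]
    (ℱ : Filtration ℕ m) (X : ℕ → Ω → ℝ) (hX : Adapted ℱ X) (hX0 : ∀ᵐ ω ∂μ, X 0 ω = 0)
    (α β : ℝ) (hα0 : 0 < α) (hα1 : α < 1) (hβ : α < β)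
    (hyp : ∃ c C x₀ : ℝ, 0 < c ∧ NegPartMomentBound μ ℱ X β C ∧
      TruncatedPosPartLowerBound μ ℱ X α c x₀)
    (x p : ℝ) (hp0 : 0 ≤ p) (hp : p < β / α - 1) :
    ∫⁻ ω, (lastExitTime X x ω : ℝ≥0∞) ^ p ∂μ < ∞ := by
  obtain ⟨c, C, x₀, hc0, hC, hc⟩ := hyp
  have hβ0 : 0 < β := hα0.trans hβ
  -- The window is nonempty because `p < β / α - 1`. Its lower end makes the dyadic series converge,
  -- its upper end makes the Chernoff term negligible.
  obtain ⟨θ, hθ1, hθ2⟩ : ∃ θ, (p + 1) / β < θ ∧ θ < 1 / α := by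
    refine exists_between ?_
    rw [div_lt_iff₀ hβ0, one_div_mul_eq_div]
    linarith
  have hθ0 : 0 < θ := (by positivity : 0 < (p + 1) / β).trans hθ1
  rw [div_lt_iff₀ hβ0] at hθ1
  rw [lt_div_iff₀ hα0, mul_comm] at hθ2
  refine lintegral_lastExitTime_rpow_lt_top hX hp0 x ?_
  have h2 : Tendsto (fun k : ℕ => (2 : ℝ) ^ k) atTop atTop :=
    tendsto_pow_atTop_atTop_of_one_lt one_lt_two
  have hy : Tendsto (fun k : ℕ => ((2 : ℝ) ^ k) ^ θ) atTop atTop :=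
    (tendsto_rpow_atTop hθ0).comp h2
  have hstep := hy.eventually (eventually_condExp_exp_neg_truncate_le hX hα0 hα1 hβ hc0 hC hc)
  have hgeom : Summable fun k : ℕ => ((2 : ℝ) ^ k) ^ (-(θ * β - 1 - p)) := by
    have : (fun k : ℕ => ((2 : ℝ) ^ k) ^ (-(θ * β - 1 - p))) =
        fun k : ℕ => ((2 : ℝ) ^ (-(θ * β - 1 - p))) ^ k := by
      ext k
      rw [← Real.rpow_natCast, ← Real.rpow_natCast, ← Real.rpow_mul zero_le_two,
        ← Real.rpow_mul zero_le_two, mul_comm]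
    rw [this]
    exact summable_geometric_of_lt_one (by positivity)
      (Real.rpow_lt_one_of_one_lt_of_neg one_lt_two (by linarith))
  refine summable_of_isBigO_nat hgeom (Asymptotics.IsBigO.trans ?_
    ((block_bound_isBigO (β := β) (p := p) (show 0 < c / 4 by positivity) hθ2 (max C 0)
      (Real.exp |x|)).comp_tendsto h2))
  refine Asymptotics.IsBigO.of_bound 1 ?_
  filter_upwards [hstep, hy.eventually_ge_atTop 1] with k hk hk1
  rw [Real.norm_of_nonneg (by positivity), one_mul]
  refine le_trans ?_ (le_abs_self _)
  have h := measure_exists_le_block_le hX hX0 hβ0 hC hk1 (by positivity) hk x (2 ^ k)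
  push_cast at h
  exact mul_le_mul_of_nonneg_left h (by positivity)
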